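/- **Definitions.** A *directed graph* $\mathcal G=(E_{\mathcal G},V_{\mathcal G},s_{\mathcal G},t_{\mathcal G})$ consists of a set $E_{\mathcal G}$ of edges, a set $V_{\mathcal G}$ of nodes, and functions $s_{\mathcal G},t_{\mathcal G}:E_{\mathcal G}\to V_{\mathcal G}$. A morphism $\mathcal G\to\mathcal H$ is a pair $(f,g)$ of functions $f:E_{\mathcal G}\to E_{\mathcal H}$, $g:V_{\mathcal G}\to V_{\mathcal H}$ with $s_{\mathcal H}\circ f=g\circ s_{\mathcal G}$ and $t_{\mathcal H}\circ f=g\circ t_{\mathcal G}$; this gives the category $\mathbf{Graph}$. A directed graph is *simple* if two edges with the same source and the same target are equal; $\mathbf{SGraph}$ is the full subcategory of $\mathbf{Graph}$ on the simple graphs. A *cycle* is a finite nonempty list of edges $e_1,\dots,e_n$ with $t(e_i)=s(e_{i+1})$ for $1\le i<n$ and $s(e_1)=t(e_n)$; $\mathbf{DAG}$ is the full subcategory of $\mathbf{Graph}$ on the simple graphs without cycles. A monomorphism $(f,g):\mathcal G\to\mathcal H$ of $\mathbf{Graph}$ is *downward closed* if every $e\in E_{\mathcal H}$ with $t_{\mathcal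 H}(e)\in g(V_{\mathcal G})$ lies in $f(E_{\mathcal G})$; $\mathsf{dclosed_d}$ is the class of arrows of $\mathbf{DAG}$ that are downward closed monomorphisms of $\mathbf{Graph}$. For a category $\mathbf A$, $\mathrm{Mono}(\mathbf A)$ and $\mathrm{Reg}(\mathbf A)$ are the classes of its monomorphisms and of its regular monomorphisms. Let $\mathbf A$ be a category, $\mathcal M\subseteq\mathrm{Mono}(\mathbf A)$ and $\mathcal N$ classes of arrows of $\mathbf A$. A class $\mathcal X$ is *closed under $\mathcal Y$-decomposition* if $g\circ f\in\mathcal X$ and $g\in\mathcal Y$ imply $f\in\mathcal X$, and *closed under decomposition* if it is closed under $\mathcal X$-decomposition. A commutative square $g\circ m=f\circ n$ with $m:A\to C$, $n:A\to B$, $g:C\to D$, $f:B\to D$ that is a pushout is *Van Kampen* if for every commutative cube having it as bottom face and pullbacks as back faces (the faces over $m$ and $n$), the top face is a pushout if and only if the front faces (the faces over $f$ and $g$) are pullbacks. The category $\mathbf A$ is *$\mathcal M,\mathcal N$-adhesive* if 1. $\mathcal M$ and $\mathcal N$ contain all isomorphisms and are closed under composition and under decomposition; $\mathcal N$ is closed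 under $\mathcal M$-decomposition; $\mathcal M$ and $\mathcal N$ are stable under all pullbacks and all pushouts that exist in $\mathbf A$; 2. every cospan $C\to D\xleftarrow{m}B$ with $m\in\mathcal M$ has a pullback; 3. every span $C\xleftarrow{m}A\xrightarrow{n}B$ with $m\in\mathcal M$ and $n\in\mathcal N$ has a pushout, and every such pushout square is Van Kampen. **Theorem.** The category $\mathbf{SGraph}$ is both $\mathrm{Reg}(\mathbf{SGraph}),\mathrm{Mono}(\mathbf{SGraph})$-adhesive and $\mathrm{Mono}(\mathbf{SGraph}),\mathrm{Reg}(\mathbf{SGraph})$-adhesive, and the category $\mathbf{DAG}$ is $\mathsf{dclosed_d},\mathrm{Mono}(\mathbf{DAG})$-adhesive. -/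

import Mathlib

open CategoryTheory CategoryTheory.Limits

universe u v

section Adhesive

variable {C : Type u} [Category.{v} C]

/-- The category `C` is `M,N`-adhesive. The first group of fields says that `M` and `N` are
admissible classes of arrows, the second one is the adhesivity property proper. -/
structure IsAdhesiveWrt (M N : MorphismProperty C) : Prop where
  /-- Every arrow in `M` is a monomorphism. -/
  le_mono : M ≤ MorphismProperty.monomorphisms C
  /-- `M` contains all isomorphisms. -/
  iso_left : MorphismProperty.isomorphisms C ≤ M
  /-- `N` contains all isomorphisms. -/
  iso_right : MorphismProperty.isomorphisms C ≤ N
  /-- `M` is closed under composition. -/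
  comp_left : ∀ ⦃X Y Z : C⦄ (f : X ⟶ Y) (g : Y ⟶ Z), M f → M g → M (f ≫ g)
  /-- `N` is closed under composition. -/
  comp_right : ∀ ⦃X Y Z : C⦄ (f : X ⟶ Y) (g : Y ⟶ Z), N f → N g → N (f ≫ g)
  /-- `M` is closed under decomposition. -/
  decomp_left : ∀ ⦃X Y Z : C⦄ (f : X ⟶ Y) (g : Y ⟶ Z), M (f ≫ g) → M g → M f
  /-- `N` is closed under decomposition. -/
  decomp_right : ∀ ⦃X Y Z : C⦄ (f : X ⟶ Y) (g : Y ⟶ Z), N (f ≫ g) → N g → N f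
  /-- `N` is closed under `M`-decomposition. -/
  decomp_mixed : ∀ ⦃X Y Z : C⦄ (f : X ⟶ Y) (g : Y ⟶ Z), N (f ≫ g) → M g → N f
  /-- `M` is stable under (all existing) pullbacks. -/
  pullback_left : M.IsStableUnderBaseChange
  /-- `N` is stable under (all existing) pullbacks. -/
  pullback_right : N.IsStableUnderBaseChange
  /-- `M` is stable under (all existing) pushouts. -/
  pushout_left : M.IsStableUnderCobaseChange
  /-- `N` is stable under (all existing) pushouts. -/
  pushout_right : N.IsStableUnderCobaseChange
  /-- Pullbacks along arrows in `M` exist. -/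
  hasPullback : ∀ ⦃X Y Z : C⦄ (g : X ⟶ Z) (m : Y ⟶ Z), M m → HasPullback g m
  /-- Pushouts of an arrow in `M` and an arrow in `N` exist. -/
  hasPushout : ∀ ⦃X Y Z : C⦄ (m : X ⟶ Y) (n : X ⟶ Z), M m → N n → HasPushout m n
  /-- Pushouts of an arrow in `M` and an arrow in `N` are Van Kampen squares. -/
  vanKampen : ∀ ⦃W X Y Z : C⦄ (m : W ⟶ X) (n : W ⟶ Y) (h : X ⟶ Z) (i : Y ⟶ Z)
    (sq : IsPushout m n h i), M m → N n → sq.IsVanKampen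

end Adhesive

/-- A directed graph: sets of edges and of nodes, with source and target functions. -/
structure DirectedGraph : Type (u + 1) where
  Edge : Type u
  Node : Type u
  source : Edge → Node
  target : Edge → Node

namespace DirectedGraph

/-- A morphism of directed graphs. -/
@[ext]
structure Hom (G H : DirectedGraph.{u}) : Type u where
  onEdge : G.Edge → H.Edge
  onNode : G.Node → H.Node
  source_onEdge : ∀ e, H.source (onEdge e) = onNode (G.source e)
  target_onEdge : ∀ e, H.target (onEdge e) = onNode (G.target e)

instance : Category.{u} DirectedGraph.{u} where
  Hom := Hom
  id G := ⟨id, id, fun _ => rfl, fun _ => rfl⟩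
  comp f g :=
    ⟨g.onEdge ∘ f.onEdge, g.onNode ∘ f.onNode,
      fun e => by simp [g.source_onEdge, f.source_onEdge],
      fun e => by simp [g.target_onEdge, f.target_onEdge]⟩

/-- A directed graph is simple if for all nodes `v`, `w` there is at most one edge from `v`
to `w`. -/
def IsSimple (G : DirectedGraph.{u}) : Prop :=
  ∀ e e' : G.Edge, G.source e = G.source e' → G.target e = G.target e' → e = e'

/-- A path is a nonempty list of consecutive edges; it is a cycle if the source of its first edge
is the target of its last edge. -/
def IsCycle (G : DirectedGraph.{u}) (p : List G.Edge) : Prop :=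
  p.IsChain (fun e e' => G.target e = G.source e') ∧
    ∃ hp : p ≠ [], G.source (p.head hp) = G.target (p.getLast hp)

/-- The property of being a directed simple graph. -/
def simple : ObjectProperty DirectedGraph.{u} := fun G => G.IsSimple

/-- The property of being a directed acyclic graph: a directed simple graph without cycles. -/
def acyclic : ObjectProperty DirectedGraph.{u} := fun G => G.IsSimple ∧ ∀ p, ¬ G.IsCycle p

/-- The downward closed monomorphisms of directed graphs. -/
def dclosed : MorphismProperty DirectedGraph.{u} := fun _ H f =>
  Mono f ∧ ∀ e : H.Edge, H.target e ∈ Set.range f.onNode → e ∈ Set.range f.onEdge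

end DirectedGraph

/-- The category of directed simple graphs, a full subcategory of directed graphs. -/
abbrev SGraph : Type (u + 1) := DirectedGraph.simple.{u}.FullSubcategory

/-- The category of directed acyclic graphs, a full subcategory of directed graphs. -/
abbrev DAG : Type (u + 1) := DirectedGraph.acyclic.{u}.FullSubcategory

/-- The class of arrows of `DAG` that are downward closed monomorphisms of directed graphs. -/
def dclosedDAG : MorphismProperty DAG.{u} :=
  DirectedGraph.dclosed.inverseImage DirectedGraph.acyclic.{u}.ι

/-! A morphism into a simple graph is determined by its function on nodes, so both categories
consist of sets with a relation and relation-preserving maps. Both are treated at once through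
`IsSimpleSieve`. Pullbacks are pullbacks of node sets in which a pair of edges gives an edge;
pushouts are pushouts of node sets whose edges are the images of the edges of the two legs
(`isPullback_iff`, `isPushout_iff`).

In these terms regular monomorphisms of simple graphs are the full embeddings
(`regularMono_simple`), and `dclosedDAG` consists of the lower embeddings (`dclosedDAG_eq`), which
are full. A pushout of a full embedding and a monomorphism is Van Kampen (`isVanKampen`): on nodes
this is adhesivity of sets, and on edges fullness handles an edge of one leg joining nodes of the
other.

For acyclic graphs the pushout must also exist. Along a lower embedding the opposite leg becomes a
lower set of the glued graph, so a cycle lies wholly in that leg or wholly outside it, hence comes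
from one of the two acyclic graphs (`acyclic_pushoutRel`). -/

namespace DirectedGraph

/-! ### Simple graphs as adjacency relations -/

/-- There is an edge from `v` to `w`. -/
def Adj (G : DirectedGraph.{u}) (v w : G.Node) : Prop :=
  ∃ e, G.source e = v ∧ G.target e = w

/-- The simple graph whose edges are the pairs of nodes related by `R`. -/
def ofRel {V : Type u} (R : V → V → Prop) : DirectedGraph.{u} where
  Edge := { p : V × V // R p.1 p.2 }
  Node := V
  source p := p.1.1
  target p := p.1.2

theorem isSimple_ofRel {V : Type u} (R : V → V → Prop) : (ofRel R).IsSimple :=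
  fun _ _ h h' => Subtype.ext (Prod.ext h h')

theorem adj_ofRel {V : Type u} (R : V → V → Prop) (v w : V) : (ofRel R).Adj v w ↔ R v w :=
  ⟨by rintro ⟨e, rfl, rfl⟩; exact e.2, fun h => ⟨⟨(v, w), h⟩, rfl, rfl⟩⟩

theorem Hom.adj {G H : DirectedGraph.{u}} (f : Hom G H) {v w : G.Node} (h : G.Adj v w) :
    H.Adj (f.onNode v) (f.onNode w) := by
  obtain ⟨e, rfl, rfl⟩ := h
  exact ⟨f.onEdge e, f.source_onEdge e, f.target_onEdge e⟩

/-- A function on nodes that preserves adjacency extends to a morphism of graphs. -/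
noncomputable def Hom.ofNode {G H : DirectedGraph.{u}} (φ : G.Node → H.Node)
    (hφ : ∀ v w, G.Adj v w → H.Adj (φ v) (φ w)) : Hom G H where
  onEdge e := (hφ _ _ ⟨e, rfl, rfl⟩).choose
  onNode := φ
  source_onEdge e := (hφ _ _ ⟨e, rfl, rfl⟩).choose_spec.1
  target_onEdge e := (hφ _ _ ⟨e, rfl, rfl⟩).choose_spec.2

theorem Hom.ext_of_isSimple {G H : DirectedGraph.{u}} (hH : H.IsSimple) {f g : Hom G H}
    (h : f.onNode = g.onNode) : f = g := by
  refine Hom.ext (funext fun e => hH _ _ ?_ ?_) h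
  · rw [f.source_onEdge, g.source_onEdge, h]
  · rw [f.target_onEdge, g.target_onEdge, h]

/-! ### Full subcategories of simple graphs -/

/-- A property of graphs is a simple sieve if it only holds for simple graphs and passes to
every simple graph that has a morphism to a graph with the property. -/
structure IsSimpleSieve (P : ObjectProperty DirectedGraph.{u}) : Prop where
  isSimple : ∀ ⦃G⦄, P G → G.IsSimple
  of_hom : ∀ ⦃G H : DirectedGraph.{u}⦄, G.IsSimple → (G ⟶ H) → P H → P G

variable {P : ObjectProperty DirectedGraph.{u}}

/-- The function on nodes of a morphism in a full subcategory of directed graphs. -/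
def node {X Y : P.FullSubcategory} (f : X ⟶ Y) : X.obj.Node → Y.obj.Node :=
  Hom.onNode f.hom

theorem node_comp {X Y Z : P.FullSubcategory} (f : X ⟶ Y) (g : Y ⟶ Z) (v : X.obj.Node) :
    node (f ≫ g) v = node g (node f v) :=
  rfl

theorem node_id {X : P.FullSubcategory} (v : X.obj.Node) : node (𝟙 X) v = v :=
  rfl

theorem adj_node {X Y : P.FullSubcategory} (f : X ⟶ Y) {v w : X.obj.Node} (h : X.obj.Adj v w) :
    Y.obj.Adj (node f v) (node f w) :=
  Hom.adj (G := X.obj) (H := Y.obj) f.hom h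

/-- The functor that sends a graph to its set of nodes. -/
def nodes (P : ObjectProperty DirectedGraph.{u}) : P.FullSubcategory ⥤ Type u where
  obj X := X.obj.Node
  map f := ↾(node f)

theorem node_inv_hom {X Y : P.FullSubcategory} (e : X ≅ Y) (v : Y.obj.Node) :
    node e.hom (node e.inv v) = v := by
  rw [← node_comp, e.inv_hom_id, node_id]

theorem node_hom_inv {X Y : P.FullSubcategory} (e : X ≅ Y) (v : X.obj.Node) :
    node e.inv (node e.hom v) = v := by
  rw [← node_comp, e.hom_inv_id, node_id]

theorem node_w {W X Y Z : P.FullSubcategory} {f : W ⟶ X} {g : W ⟶ Y} {h : X ⟶ Z} {i : Y ⟶ Z}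
    (w : f ≫ h = g ≫ i) (v : W.obj.Node) : node h (node f v) = node i (node g v) := by
  rw [← node_comp, w, node_comp]

/-- The morphism given by a function on nodes that preserves adjacency. -/
noncomputable def ofNode {X Y : P.FullSubcategory} (φ : X.obj.Node → Y.obj.Node)
    (hφ : ∀ v w, X.obj.Adj v w → Y.obj.Adj (φ v) (φ w)) : X ⟶ Y :=
  ObjectProperty.homMk (Hom.ofNode φ hφ)

theorem IsSimpleSieve.hom_ext (hP : IsSimpleSieve P) {X Y : P.FullSubcategory} {f g : X ⟶ Y}
    (h : ∀ v, node f v = node g v) : f = g :=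
  ObjectProperty.hom_ext _ (Hom.ext_of_isSimple (hP.isSimple Y.property) (funext h))

/-- The adjacency relation of the pushout in simple graphs. -/
def pushoutRel {W X Y : P.FullSubcategory} (f : W ⟶ X) (g : W ⟶ Y)
    (v w : Types.Pushout (↾node f) (↾node g)) : Prop :=
  Relation.Map X.obj.Adj (Types.Pushout.inl (↾node f) (↾node g))
    (Types.Pushout.inl (↾node f) (↾node g)) v w ∨
  Relation.Map Y.obj.Adj (Types.Pushout.inr (↾node f) (↾node g))
    (Types.Pushout.inr (↾node f) (↾node g)) v w

/-! ### Monomorphisms, pullbacks and pushouts in terms of nodes and adjacency -/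

namespace IsSimpleSieve

theorem mono_of_injective (hP : IsSimpleSieve P) {X Y : P.FullSubcategory} {f : X ⟶ Y}
    (hf : Function.Injective (node f)) : Mono f where
  right_cancellation a b h := hP.hom_ext fun v => hf <| by rw [← node_comp, h, node_comp]

theorem mono_iff (hP : IsSimpleSieve P) {X Y : P.FullSubcategory} (f : X ⟶ Y) :
    Mono f ↔ Function.Injective (node f) := by
  refine ⟨fun _ v w h => ?_, hP.mono_of_injective⟩
  -- Nodes of `X` are maps from the one-node graph without edges; it satisfies `P` because it maps
  -- to `X`.
  let φ (v : X.obj.Node) : Hom (ofRel fun _ _ : PUnit.{u + 1} => False) X.obj :=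
    Hom.ofNode (fun _ => v) fun _ _ h => ((adj_ofRel _ _ _).1 h).elim
  let T : P.FullSubcategory := ⟨_, hP.of_hom (isSimple_ofRel _) (φ v) X.property⟩
  let a (v : X.obj.Node) : T ⟶ X := ObjectProperty.homMk (φ v)
  have hab : a v = a w := (cancel_mono f).1 (hP.hom_ext fun _ => h)
  exact congrFun (congrArg node hab) PUnit.unit

/-- Squares that are pullbacks on nodes and reflect edges are pullbacks. -/
theorem isPullback (hP : IsSimpleSieve P) {W X Y Z : P.FullSubcategory} {f : W ⟶ X} {g : W ⟶ Y}
    {h : X ⟶ Z} {i : Y ⟶ Z} (hn : IsPullback (↾node f) (↾node g) (↾node h) (↾node i))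
    (he : ∀ v w, X.obj.Adj (node f v) (node f w) → Y.obj.Adj (node g v) (node g w) →
      W.obj.Adj v w) : IsPullback f g h i := by
  have w : f ≫ h = g ≫ i := hP.hom_ext fun v => ConcreteCategory.congr_hom hn.w v
  refine ⟨⟨w⟩, ⟨PullbackCone.IsLimit.mk w (fun s => ?_) (fun s => ?_) (fun s => ?_)
    fun s m hm hm' => ?_⟩⟩
  all_goals
    have hs : (↾node s.fst) ≫ (↾node h) = (↾node s.snd) ≫ (↾node i) :=
      (nodes P).congr_map s.condition
    have h₁ (v) : node f (hn.lift _ _ hs v) = node s.fst v :=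
      ConcreteCategory.congr_hom (hn.lift_fst _ _ hs) v
    have h₂ (v) : node g (hn.lift _ _ hs v) = node s.snd v :=
      ConcreteCategory.congr_hom (hn.lift_snd _ _ hs) v
  · refine ofNode (hn.lift _ _ hs) fun v w hvw => he _ _ ?_ ?_
    · rw [h₁, h₁]
      exact adj_node _ hvw
    · rw [h₂, h₂]
      exact adj_node _ hvw
  · exact hP.hom_ext h₁
  · exact hP.hom_ext h₂
  · exact hP.hom_ext fun v => Types.ext_of_isPullback hn
      ((congrFun (congrArg node hm) v).trans (h₁ v).symm)
      ((congrFun (congrArg node hm') v).trans (h₂ v).symm)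

theorem exists_isPullback (hP : IsSimpleSieve P) {X Y Z : P.FullSubcategory} (h : X ⟶ Z)
    (i : Y ⟶ Z) : ∃ (W : P.FullSubcategory) (f : W ⟶ X) (g : W ⟶ Y), IsPullback f g h i ∧
      IsPullback (↾node f) (↾node g) (↾node h) (↾node i) ∧
      ∀ v w, X.obj.Adj (node f v) (node f w) → Y.obj.Adj (node g v) (node g w) →
        W.obj.Adj v w := by
  let R (p q : { p : X.obj.Node × Y.obj.Node // node h p.1 = node i p.2 }) : Prop :=
    X.obj.Adj p.1.1 q.1.1 ∧ Y.obj.Adj p.1.2 q.1.2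
  have hR := adj_ofRel R
  let f : Hom (ofRel R) X.obj := Hom.ofNode (fun p => p.1.1) fun p q hpq => ((hR p q).1 hpq).1
  let g : Hom (ofRel R) Y.obj := Hom.ofNode (fun p => p.1.2) fun p q hpq => ((hR p q).1 hpq).2
  let W : P.FullSubcategory := ⟨_, hP.of_hom (isSimple_ofRel R) f X.property⟩
  let f' : W ⟶ X := ObjectProperty.homMk f
  let g' : W ⟶ Y := ObjectProperty.homMk g
  have hn : IsPullback (↾node f') (↾node g') (↾node h) (↾node i) := by
    rw [Types.isPullback_iff]
    refine ⟨?_, fun p q hpq => Subtype.ext (Prod.ext hpq.1 hpq.2),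
      fun x y hxy => ⟨⟨(x, y), hxy⟩, rfl, rfl⟩⟩
    ext p
    exact p.2
  have he (p q) (h₁ : X.obj.Adj (node f' p) (node f' q)) (h₂ : Y.obj.Adj (node g' p) (node g' q)) :
      W.obj.Adj p q := (hR p q).2 ⟨h₁, h₂⟩
  exact ⟨W, f', g', hP.isPullback hn he, hn, he⟩

theorem isPullback_iff (hP : IsSimpleSieve P) {W X Y Z : P.FullSubcategory} (f : W ⟶ X)
    (g : W ⟶ Y) (h : X ⟶ Z) (i : Y ⟶ Z) : IsPullback f g h i ↔
      IsPullback (↾node f) (↾node g) (↾node h) (↾node i) ∧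
      ∀ v w, X.obj.Adj (node f v) (node f w) → Y.obj.Adj (node g v) (node g w) →
        W.obj.Adj v w := by
  refine ⟨fun sq => ?_, fun hn => hP.isPullback hn.1 hn.2⟩
  obtain ⟨W', f', g', sq', hn, he⟩ := hP.exists_isPullback h i
  let e : W ≅ W' := sq.isoIsPullback _ _ sq'
  have hf : e.hom ≫ f' = f := sq.isoIsPullback_hom_fst _ _ sq'
  have hg : e.hom ≫ g' = g := sq.isoIsPullback_hom_snd _ _ sq'
  refine ⟨hn.of_iso' ((nodes P).mapIso e) (Iso.refl _) (Iso.refl _) (Iso.refl _) ?_ ?_ rfl rfl,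
    fun v w h₁ h₂ => ?_⟩
  · exact (nodes P).congr_map hf
  · exact (nodes P).congr_map hg
  · rw [← hf] at h₁
    rw [← hg] at h₂
    have := adj_node e.inv (he (node e.hom v) (node e.hom w) h₁ h₂)
    rwa [node_hom_inv, node_hom_inv] at this

/-- Squares that are pushouts on nodes and jointly surjective on edges are pushouts. -/
theorem isPushout (hP : IsSimpleSieve P) {W X Y Z : P.FullSubcategory} {f : W ⟶ X} {g : W ⟶ Y}
    {h : X ⟶ Z} {i : Y ⟶ Z} (hn : IsPushout (↾node f) (↾node g) (↾node h) (↾node i))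
    (he : ∀ v w, Z.obj.Adj v w → Relation.Map X.obj.Adj (node h) (node h) v w ∨
      Relation.Map Y.obj.Adj (node i) (node i) v w) : IsPushout f g h i := by
  have w : f ≫ h = g ≫ i := hP.hom_ext fun v => ConcreteCategory.congr_hom hn.w v
  refine ⟨⟨w⟩, ⟨PushoutCocone.IsColimit.mk w (fun s => ?_) (fun s => ?_) (fun s => ?_)
    fun s m hm hm' => ?_⟩⟩
  all_goals
    have hs : (↾node f) ≫ (↾node s.inl) = (↾node g) ≫ (↾node s.inr) :=
      (nodes P).congr_map s.condition
    have h₁ (v) : hn.desc _ _ hs (node h v) = node s.inl v :=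
      ConcreteCategory.congr_hom (hn.inl_desc _ _ hs) v
    have h₂ (v) : hn.desc _ _ hs (node i v) = node s.inr v :=
      ConcreteCategory.congr_hom (hn.inr_desc _ _ hs) v
  · refine ofNode (hn.desc _ _ hs) fun v w hvw => ?_
    obtain ⟨x, y, hxy, rfl, rfl⟩ | ⟨x, y, hxy, rfl, rfl⟩ := he v w hvw
    · rw [h₁, h₁]
      exact adj_node _ hxy
    · rw [h₂, h₂]
      exact adj_node _ hxy
  · exact hP.hom_ext h₁
  · exact hP.hom_ext h₂
  · refine hP.hom_ext fun v => ?_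
    obtain ⟨x, rfl⟩ | ⟨x, rfl⟩ := Types.eq_or_eq_of_isPushout hn v
    · exact (congrFun (congrArg node hm) x).trans (h₁ x).symm
    · exact (congrFun (congrArg node hm') x).trans (h₂ x).symm

theorem exists_isPushout (hP : IsSimpleSieve P) {W X Y : P.FullSubcategory} (f : W ⟶ X)
    (g : W ⟶ Y) (hZ : P (ofRel (pushoutRel f g))) :
    ∃ (Z : P.FullSubcategory) (h : X ⟶ Z) (i : Y ⟶ Z), IsPushout f g h i ∧
      IsPushout (↾node f) (↾node g) (↾node h) (↾node i) ∧
      ∀ v w, Z.obj.Adj v w → Relation.Map X.obj.Adj (node h) (node h) v w ∨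
        Relation.Map Y.obj.Adj (node i) (node i) v w := by
  have hR := adj_ofRel (pushoutRel f g)
  let Z : P.FullSubcategory := ⟨_, hZ⟩
  let h : X ⟶ Z := ofNode (Types.Pushout.inl (↾node f) (↾node g))
    fun v w hvw => (hR _ _).2 (Or.inl ⟨v, w, hvw, rfl, rfl⟩)
  let i : Y ⟶ Z := ofNode (Types.Pushout.inr (↾node f) (↾node g))
    fun v w hvw => (hR _ _).2 (Or.inr ⟨v, w, hvw, rfl, rfl⟩)
  have hn : IsPushout (↾node f) (↾node g) (↾node h) (↾node i) :=
    ⟨⟨Types.Pushout.condition _ _⟩, ⟨Types.Pushout.isColimitCocone _ _⟩⟩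
  have he (v w) (hvw : Z.obj.Adj v w) : Relation.Map X.obj.Adj (node h) (node h) v w ∨
      Relation.Map Y.obj.Adj (node i) (node i) v w := (hR v w).1 hvw
  exact ⟨Z, h, i, hP.isPushout hn he, hn, he⟩

/-- Not every span need have a pushout, but if one exists, the glued graph `ofRel (pushoutRel f g)`
maps to it and so satisfies `P`. It is then itself a pushout, and the given one is isomorphic to it.
-/
theorem isPushout_iff (hP : IsSimpleSieve P) {W X Y Z : P.FullSubcategory} (f : W ⟶ X)
    (g : W ⟶ Y) (h : X ⟶ Z) (i : Y ⟶ Z) : IsPushout f g h i ↔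
      IsPushout (↾node f) (↾node g) (↾node h) (↾node i) ∧
      ∀ v w, Z.obj.Adj v w → Relation.Map X.obj.Adj (node h) (node h) v w ∨
        Relation.Map Y.obj.Adj (node i) (node i) v w := by
  refine ⟨fun sq => ?_, fun hn => hP.isPushout hn.1 hn.2⟩
  have hs : (↾node f) ≫ (↾node h) = (↾node g) ≫ (↾node i) := (nodes P).congr_map sq.w
  have hc : IsPushout (↾node f) (↾node g) (Types.Pushout.inl (↾node f) (↾node g))
      (Types.Pushout.inr (↾node f) (↾node g)) :=
    ⟨⟨Types.Pushout.condition _ _⟩, ⟨Types.Pushout.isColimitCocone _ _⟩⟩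
  have h₁ (v) : hc.desc _ _ hs (Types.Pushout.inl (↾node f) (↾node g) v) = node h v :=
    ConcreteCategory.congr_hom (hc.inl_desc _ _ hs) v
  have h₂ (v) : hc.desc _ _ hs (Types.Pushout.inr (↾node f) (↾node g) v) = node i v :=
    ConcreteCategory.congr_hom (hc.inr_desc _ _ hs) v
  let d : Hom (ofRel (pushoutRel f g)) Z.obj := Hom.ofNode (hc.desc _ _ hs) fun v w hvw => by
    obtain ⟨x, y, hxy, rfl, rfl⟩ | ⟨x, y, hxy, rfl, rfl⟩ := (adj_ofRel _ _ _).1 hvw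
    · rw [h₁, h₁]
      exact adj_node _ hxy
    · rw [h₂, h₂]
      exact adj_node _ hxy
  obtain ⟨Z', h', i', sq', hn, he⟩ :=
    hP.exists_isPushout f g (hP.of_hom (isSimple_ofRel _) d Z.property)
  let e : Z' ≅ Z := sq'.isoIsPushout _ _ sq
  have hh : h' ≫ e.hom = h := sq'.inl_isoIsPushout_hom _ _ sq
  have hi : i' ≫ e.hom = i := sq'.inr_isoIsPushout_hom _ _ sq
  refine ⟨hn.of_iso (Iso.refl _) (Iso.refl _) (Iso.refl _) ((nodes P).mapIso e) rfl rfl ?_ ?_,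
    fun v w hvw => ?_⟩
  · exact (nodes P).congr_map hh
  · exact (nodes P).congr_map hi
  · obtain ⟨x, y, hxy, hx, hy⟩ | ⟨x, y, hxy, hx, hy⟩ := he _ _ (adj_node e.inv hvw)
    · refine Or.inl ⟨x, y, hxy, ?_, ?_⟩
      · rw [← hh, node_comp, hx, node_inv_hom]
      · rw [← hh, node_comp, hy, node_inv_hom]
    · refine Or.inr ⟨x, y, hxy, ?_, ?_⟩
      · rw [← hi, node_comp, hx, node_inv_hom]
      · rw [← hi, node_comp, hy, node_inv_hom]

end IsSimpleSieve

/-! ### Full embeddings and lower embeddings -/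

/-- The morphisms that are injective on nodes and reflect edges. -/
def fullEmbedding (P : ObjectProperty DirectedGraph.{u}) : MorphismProperty P.FullSubcategory :=
  fun X Y f => Function.Injective (node f) ∧
    ∀ v w, Y.obj.Adj (node f v) (node f w) → X.obj.Adj v w

/-- The morphisms that are injective on nodes and lift the edges whose target is in the image. -/
def lowerEmbedding (P : ObjectProperty DirectedGraph.{u}) : MorphismProperty P.FullSubcategory :=
  fun X Y f => Function.Injective (node f) ∧
    ∀ v w, Y.obj.Adj v (node f w) → ∃ u, node f u = v ∧ X.obj.Adj u w

theorem lowerEmbedding_le_fullEmbedding : lowerEmbedding P ≤ fullEmbedding P := by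
  refine fun X Y f hf => ⟨hf.1, fun v w h => ?_⟩
  obtain ⟨u, hu, huw⟩ := hf.2 _ _ h
  rwa [← hf.1 hu]

/-- If an edge of `X` ends in the image of `Y`, its target comes from `W`, and the lower embedding
lifts the whole edge to `W`. `Z` is not assumed to satisfy `P`, so that this also applies to a glued
graph not yet known to be acyclic. -/
theorem exists_adj_inr {W X Y : P.FullSubcategory} {f : W ⟶ X} {g : W ⟶ Y}
    {Z : DirectedGraph.{u}} {h : X.obj.Node → Z.Node} {i : Y.obj.Node → Z.Node}
    (hn : IsPushout (↾node f) (↾node g) (↾h) (↾i))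
    (he : ∀ v w, Z.Adj v w →
      Relation.Map X.obj.Adj h h v w ∨ Relation.Map Y.obj.Adj i i v w)
    (hf : lowerEmbedding P f) {v : Z.Node} {w : Y.obj.Node} (hvw : Z.Adj v (i w)) :
    ∃ u, i u = v ∧ Y.obj.Adj u w := by
  obtain ⟨x, y, hxy, rfl, hy⟩ | ⟨x, y, hxy, rfl, hy⟩ := he _ _ hvw
  · obtain ⟨b, rfl, rfl⟩ :=
      Types.exists_of_isPullback (Types.isPullback_of_isPushout hn hf.1) y w hy
    obtain ⟨a, rfl, hab⟩ := hf.2 _ _ hxy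
    exact ⟨node g a, (ConcreteCategory.congr_hom hn.w a).symm, adj_node g hab⟩
  · obtain rfl : y = w := Types.pushoutCocone_inr_injective_of_isColimit hn.isColimit hf.1 hy
    exact ⟨x, rfl, hxy⟩

/-! ### Stability of the classes and the Van Kampen property -/

namespace IsSimpleSieve

theorem isStableUnderBaseChange_fullEmbedding (hP : IsSimpleSieve P) :
    (fullEmbedding P).IsStableUnderBaseChange where
  of_isPullback {X Y Y' S f g f' g'} sq hg := by
    obtain ⟨hn, he⟩ := (hP.isPullback_iff _ _ _ _).1 sq
    have hg' : Function.Injective (node g') := fun v w h => Types.ext_of_isPullback hn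
      (hg.1 <| (node_w sq.w v).trans <| (congrArg _ h).trans (node_w sq.w w).symm) h
    refine ⟨hg', fun v w h => he _ _ (hg.2 _ _ ?_) h⟩
    rw [node_w sq.w, node_w sq.w]
    exact adj_node f h

theorem isStableUnderBaseChange_lowerEmbedding (hP : IsSimpleSieve P) :
    (lowerEmbedding P).IsStableUnderBaseChange where
  of_isPullback {X Y Y' S f g f' g'} sq hg := by
    obtain ⟨hn, he⟩ := (hP.isPullback_iff _ _ _ _).1 sq
    have hg' : Function.Injective (node g') := fun v w h => Types.ext_of_isPullback hn
      (hg.1 <| (node_w sq.w v).trans <| (congrArg _ h).trans (node_w sq.w w).symm) h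
    refine ⟨hg', fun v w h => ?_⟩
    have h' := adj_node f h
    rw [← node_w sq.w] at h'
    obtain ⟨u, hu, huw⟩ := hg.2 _ _ h'
    obtain ⟨t, rfl, rfl⟩ := Types.exists_of_isPullback hn _ _ hu
    exact ⟨t, rfl, he _ _ huw h⟩

theorem isStableUnderCobaseChange_monomorphisms (hP : IsSimpleSieve P) :
    (MorphismProperty.monomorphisms P.FullSubcategory).IsStableUnderCobaseChange where
  of_isPushout sq hf := (hP.mono_iff _).2 <|
    Types.pushoutCocone_inr_injective_of_isColimit
      ((hP.isPushout_iff _ _ _ _).1 sq).1.flip.isColimit ((hP.mono_iff _).1 hf)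

theorem isStableUnderCobaseChange_fullEmbedding (hP : IsSimpleSieve P) :
    (fullEmbedding P).IsStableUnderCobaseChange where
  of_isPushout {X Y Y' S f g f' g'} sq hf := by
    obtain ⟨hn, he⟩ := (hP.isPushout_iff _ _ _ _).1 sq.flip
    have hi := Types.pushoutCocone_inr_injective_of_isColimit hn.isColimit hf.1
    refine ⟨hi, fun v w hvw => ?_⟩
    obtain ⟨x, y, hxy, hx, hy⟩ | ⟨x, y, hxy, hx, hy⟩ := he _ _ hvw
    -- An edge of the other leg between nodes of this one has both ends in the common part, and
    -- fullness puts the edge there too.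
    · have hp := Types.isPullback_of_isPushout hn hf.1
      obtain ⟨a, rfl, rfl⟩ := Types.exists_of_isPullback hp x v hx
      obtain ⟨b, rfl, rfl⟩ := Types.exists_of_isPullback hp y w hy
      exact adj_node _ (hf.2 _ _ hxy)
    · rwa [← hi hx, ← hi hy]

theorem isStableUnderCobaseChange_lowerEmbedding (hP : IsSimpleSieve P) :
    (lowerEmbedding P).IsStableUnderCobaseChange where
  of_isPushout {X Y Y' S f g f' g'} sq hf := by
    obtain ⟨hn, he⟩ := (hP.isPushout_iff _ _ _ _).1 sq.flip
    exact ⟨Types.pushoutCocone_inr_injective_of_isColimit hn.isColimit hf.1,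
      fun v w hvw => exists_adj_inr hn he hf hvw⟩

theorem isVanKampen (hP : IsSimpleSieve P) {W X Y Z : P.FullSubcategory} {f : W ⟶ X}
    {g : W ⟶ Y} {h : X ⟶ Z} {i : Y ⟶ Z} (sq : IsPushout f g h i) (hf : fullEmbedding P f)
    (hg : Mono g) : sq.IsVanKampen := by
  intro W' X' Y' Z' f' g' h' i' αW αX αY αZ hpf hpg ch ci ct
  have hf' := hP.isStableUnderBaseChange_fullEmbedding.of_isPullback hpf.flip hf
  have hg' : Mono g' := (MorphismProperty.monomorphisms _).of_isPullback hpg.flip hg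
  rw [hP.mono_iff] at hg'
  rw [hP.isPullback_iff] at hpf hpg
  obtain ⟨hn, he⟩ := (hP.isPushout_iff _ _ _ _).1 sq
  have : Mono (↾node f) := (mono_iff_injective _).2 hf.1
  have hvk := Adhesive.van_kampen hn (↾node f') (↾node g') (↾node h') (↾node i') (↾node αW)
    (↾node αX) (↾node αY) (↾node αZ) hpf.1 hpg.1 ⟨(nodes P).congr_map ch.w⟩
    ⟨(nodes P).congr_map ci.w⟩ ⟨(nodes P).congr_map ct.w⟩
  rw [hP.isPushout_iff, hP.isPullback_iff, hP.isPullback_iff]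
  constructor
  · rintro ⟨hn', he'⟩
    obtain ⟨h₁, h₂⟩ := hvk.1 hn'
    have hi := Types.pushoutCocone_inr_injective_of_isColimit hn'.isColimit hf'.1
    have hh := Types.pushoutCocone_inr_injective_of_isColimit hn'.flip.isColimit hg'
    have hp := Types.isPullback_of_isPushout hn' hf'.1
    refine ⟨⟨h₁, fun v w hZ hX => ?_⟩, ⟨h₂, fun v w hZ hY => ?_⟩⟩
    · obtain ⟨x, y, hxy, hx, hy⟩ | ⟨x, y, hxy, hx, hy⟩ := he' _ _ hZ
      · rwa [← hh hx, ← hh hy]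
      -- The edge of `Z'` comes from `Y'` but joins nodes of `X'`, so its ends come from `W'`.
      -- Fullness of `f` gives an edge in `W`, and the back face over `g` lifts it to `W'`.
      · obtain ⟨a, rfl, rfl⟩ := Types.exists_of_isPullback hp v x hx.symm
        obtain ⟨b, rfl, rfl⟩ := Types.exists_of_isPullback hp w y hy.symm
        have ha (a) : node αX (node f' a) = node f (node αW a) :=
          ConcreteCategory.congr_hom hpf.1.w a
        refine adj_node f' (hpg.2 a b hxy (hf.2 _ _ ?_))
        rw [← ha, ← ha]
        exact hX
    · obtain ⟨x, y, hxy, hx, hy⟩ | ⟨x, y, hxy, hx, hy⟩ := he' _ _ hZ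
      · obtain ⟨a, rfl, rfl⟩ := Types.exists_of_isPullback hp x v hx
        obtain ⟨b, rfl, rfl⟩ := Types.exists_of_isPullback hp y w hy
        exact adj_node g' (hf'.2 _ _ hxy)
      · rwa [← hi hx, ← hi hy]
  · rintro ⟨⟨h₁, e₁⟩, ⟨h₂, e₂⟩⟩
    refine ⟨hvk.2 ⟨h₁, h₂⟩, fun v w hvw => ?_⟩
    -- The image of the edge in `Z` comes from `X` or `Y`; the corresponding front pullback lifts
    -- it.
    obtain ⟨x, y, hxy, hx, hy⟩ | ⟨x, y, hxy, hx, hy⟩ := he _ _ (adj_node αZ hvw)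
    · obtain ⟨a, rfl, rfl⟩ := Types.exists_of_isPullback h₁ v x hx.symm
      obtain ⟨b, rfl, rfl⟩ := Types.exists_of_isPullback h₁ w y hy.symm
      exact Or.inl ⟨a, b, e₁ _ _ hvw hxy, rfl, rfl⟩
    · obtain ⟨a, rfl, rfl⟩ := Types.exists_of_isPullback h₂ v x hx.symm
      obtain ⟨b, rfl, rfl⟩ := Types.exists_of_isPullback h₂ w y hy.symm
      exact Or.inr ⟨a, b, e₂ _ _ hvw hxy, rfl, rfl⟩

end IsSimpleSieve

/-! ### Regular monomorphisms of simple graphs -/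

theorem isSimpleSieve_simple : IsSimpleSieve simple.{u} where
  isSimple _ h := h
  of_hom _ _ h _ _ := h

theorem regularMono_simple : MorphismProperty.regularMono SGraph.{u} = fullEmbedding simple := by
  ext X Y f
  have hP := isSimpleSieve_simple.{u}
  constructor
  · rintro ⟨⟨r⟩⟩
    have hf : Function.Injective (node f) := (hP.mono_iff f).1 r.mono
    refine ⟨hf, fun v w hvw => ?_⟩
    -- The graph with a single edge between two nodes: the equalizer property turns an edge of `Y`
    -- between nodes of `X` into an edge of `X`.
    let T : SGraph.{u} := ⟨ofRel fun a b : ULift.{u} Bool => a.down = false ∧ b.down = true,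
      isSimple_ofRel _⟩
    let t : T ⟶ Y := ofNode (fun a => node f (bif a.down then w else v)) fun a b hab => by
      obtain ⟨ha, hb⟩ := (adj_ofRel _ _ _).1 hab
      simpa [ha, hb] using hvw
    have ht : t ≫ r.left = t ≫ r.right := hP.hom_ext fun a => node_w r.w _
    obtain ⟨(l : T ⟶ X), hl⟩ := Fork.IsLimit.lift' r.isLimit t ht
    have hl' (a) : node l a = bif a.down then w else v := hf (congrFun (congrArg node hl) a)
    have h₀ : node l ⟨false⟩ = v := hl' _
    have h₁ : node l ⟨true⟩ = w := hl' _
    rw [← h₀, ← h₁]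
    exact adj_node l ((adj_ofRel _ _ _).2 ⟨rfl, rfl⟩)
  · rintro ⟨hf, he⟩
    have hm : Mono f := hP.mono_of_injective hf
    -- In the complete graph on truth values, loops included, every function on nodes is a morphism.
    -- Hence `f` is the equalizer of the characteristic map of its image and the constant map
    -- `True`.
    let K : SGraph.{u} := ⟨ofRel fun _ _ : ULift.{u} Prop => True, isSimple_ofRel _⟩
    let a (p : Y.obj.Node → Prop) : Y ⟶ K := ofNode (fun v => ⟨p v⟩) fun _ _ _ =>
      (adj_ofRel _ _ _).2 trivial
    have hw : f ≫ a (· ∈ Set.range (node f)) = f ≫ a fun _ => True :=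
      hP.hom_ext fun v => congrArg ULift.up (eq_true ⟨v, rfl⟩)
    refine isRegularMono_of_regularMono ⟨K, _, _, hw, Fork.IsLimit.mk' _ fun s => ?_⟩
    have hs (v) : node s.ι v ∈ Set.range (node f) :=
      of_eq_true (congrArg ULift.down (congrFun (congrArg node s.condition) v))
    choose φ hφ using hs
    refine ⟨ofNode φ fun v w hvw => he _ _ ?_, hP.hom_ext hφ, fun {m} hm' => ?_⟩
    · rw [hφ, hφ]
      exact adj_node _ hvw
    · exact (cancel_mono f).1 (hm'.trans (hP.hom_ext hφ).symm)

/-! ### Cycles, and pushouts of acyclic graphs -/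

/-- A graph has no cycles if and only if the transitive closure of adjacency is irreflexive. -/
theorem forall_not_isCycle_iff (G : DirectedGraph.{u}) :
    (∀ p, ¬ G.IsCycle p) ↔ ∀ v, ¬ Relation.TransGen G.Adj v v := by
  have h₁ {v w} (h : Relation.TransGen G.Adj v w) : ∃ (p : List G.Edge) (hp : p ≠ []),
      p.IsChain (fun e e' => G.target e = G.source e') ∧ G.source (p.head hp) = v ∧
        G.target (p.getLast hp) = w := by
    induction h using Relation.TransGen.head_induction_on with
    | single h =>
      obtain ⟨e, rfl, rfl⟩ := h
      exact ⟨[e], by simp, by simp, rfl, rfl⟩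
    | head h _ ih =>
      obtain ⟨e, rfl, rfl⟩ := h
      obtain ⟨_ | ⟨e', p⟩, hp, hc, hs, ht⟩ := ih
      · exact (hp rfl).elim
      · exact ⟨e :: e' :: p, by simp, List.isChain_cons_cons.2 ⟨hs.symm, hc⟩, rfl, ht⟩
  have h₂ (p : List G.Edge) (e : G.Edge)
      (h : (e :: p).IsChain fun e e' => G.target e = G.source e') :
      Relation.TransGen G.Adj (G.source e) (G.target ((e :: p).getLast (by simp))) := by
    induction p generalizing e with
    | nil => exact .single ⟨e, rfl, rfl⟩
    | cons e' p ih =>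
      rw [List.isChain_cons_cons] at h
      exact .head ⟨e, rfl, h.1⟩ (ih e' h.2)
  refine ⟨fun h v hv => ?_, fun h p hp => ?_⟩
  · obtain ⟨p, hp, hc, hs, ht⟩ := h₁ hv
    exact h p ⟨hc, hp, hs.trans ht.symm⟩
  · obtain ⟨hc, hp, hst⟩ := hp
    obtain _ | ⟨e, p⟩ := p
    · exact hp rfl
    · exact h (G.source e) (by simpa [← hst] using h₂ p e hc)

theorem isSimpleSieve_acyclic : IsSimpleSieve acyclic.{u} where
  isSimple _ h := h.1
  of_hom G H hG f hH := by
    refine ⟨hG, (forall_not_isCycle_iff G).2 fun v hv => ?_⟩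
    exact (forall_not_isCycle_iff H).1 hH.2 _
      (hv.lift (Hom.onNode f) fun _ _ h => Hom.adj f h)

/-- Fullness of `f` would not suffice: two paths of length two in opposite directions, glued along
their discrete sets of endpoints, form a cycle. -/
theorem acyclic_pushoutRel {W X Y : DAG.{u}} {f : W ⟶ X} {g : W ⟶ Y}
    (hf : lowerEmbedding acyclic f) (hg : Mono g) : acyclic (ofRel (pushoutRel f g)) := by
  have hn : IsPushout (↾node f) (↾node g) (Types.Pushout.inl (↾node f) (↾node g))
      (Types.Pushout.inr (↾node f) (↾node g)) :=
    ⟨⟨Types.Pushout.condition _ _⟩, ⟨Types.Pushout.isColimitCocone _ _⟩⟩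
  -- Only the pushout property and the description `he` of the edges are used about the two node
  -- maps.
  generalize hh : Types.Pushout.inl (↾node f) (↾node g) = h at hn
  generalize hi : Types.Pushout.inr (↾node f) (↾node g) = i at hn
  have he (v w) (hvw : (ofRel (pushoutRel f g)).Adj v w) :
      Relation.Map X.obj.Adj h h v w ∨ Relation.Map Y.obj.Adj i i v w := by
    subst hh hi
    exact (adj_ofRel _ v w).1 hvw
  have h_inj := Types.pushoutCocone_inr_injective_of_isColimit hn.flip.isColimit
    ((isSimpleSieve_acyclic.mono_iff g).1 hg)
  have i_inj := Types.pushoutCocone_inr_injective_of_isColimit hn.isColimit hf.1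
  -- A path ending in the image of `Y` lifts to `Y`, edge by edge backwards from its end.
  have hlow {v w} (hvw : Relation.TransGen (ofRel (pushoutRel f g)).Adj v (i w)) :
      ∃ u, i u = v ∧ Relation.TransGen Y.obj.Adj u w := by
    induction hvw using Relation.TransGen.head_induction_on with
    | single hvw =>
      obtain ⟨u, hu, huw⟩ := exists_adj_inr hn he hf hvw
      exact ⟨u, hu, .single huw⟩
    | head hvw _ ih =>
      obtain ⟨t, rfl, ht⟩ := ih
      obtain ⟨u, hu, hut⟩ := exists_adj_inr hn he hf hvw
      exact ⟨u, hu, .head hut ht⟩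
  -- A path starting outside the image of `Y` never enters it, by `hlow`, so all its edges come from
  -- `X`; injectivity of `h` makes their lifts consecutive.
  have hup {v w} (hvw : Relation.TransGen (ofRel (pushoutRel f g)).Adj v w)
      (hv : v ∉ Set.range i) : Relation.Map (Relation.TransGen X.obj.Adj) h h v w := by
    induction hvw with
    | single hvw =>
      obtain ⟨x, y, hxy, rfl, rfl⟩ | ⟨x, y, hxy, rfl, rfl⟩ := he _ _ hvw
      · exact ⟨x, y, .single hxy, rfl, rfl⟩
      · exact (hv ⟨x, rfl⟩).elim
    | tail hvt htw ih =>
      obtain ⟨a, b, hab, rfl, rfl⟩ := ih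
      obtain ⟨x, y, hxy, hx, rfl⟩ | ⟨x, y, hxy, hx, rfl⟩ := he _ _ htw
      · obtain rfl := h_inj hx
        exact ⟨a, y, hab.tail hxy, rfl, rfl⟩
      · rw [← hx] at hvt
        obtain ⟨u, hu, -⟩ := hlow hvt
        exact (hv ⟨u, hu⟩).elim
  refine ⟨isSimple_ofRel _, (forall_not_isCycle_iff _).2 fun v hv => ?_⟩
  by_cases hvi : v ∈ Set.range i
  · obtain ⟨y, rfl⟩ := hvi
    obtain ⟨u, hu, huy⟩ := hlow hv
    rw [i_inj hu] at huy
    exact (forall_not_isCycle_iff _).1 Y.property.2 _ huy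
  · obtain ⟨a, b, hab, rfl, hb⟩ := hup hv hvi
    rw [h_inj hb] at hab
    exact (forall_not_isCycle_iff _).1 X.property.2 _ hab

/-! ### Downward closed monomorphisms as lower embeddings -/

theorem mono_of_injective_onNode {G H : DirectedGraph.{u}} (hG : G.IsSimple) (f : G ⟶ H)
    (hf : Function.Injective (Hom.onNode f)) : Mono f where
  right_cancellation a b h := by
    refine Hom.ext_of_isSimple hG (funext fun v => hf ?_)
    exact congrFun (congrArg Hom.onNode h) v

theorem injective_onNode {G H : DirectedGraph.{u}} (f : G ⟶ H) [Mono f] :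
    Function.Injective (Hom.onNode f) := fun v w h => by
  let a (v : G.Node) : ofRel (fun _ _ : PUnit.{u + 1} => False) ⟶ G :=
    Hom.ofNode (fun _ => v) fun _ _ h => ((adj_ofRel _ _ _).1 h).elim
  have hab : a v = a w := (cancel_mono f).1 <|
    Hom.ext (funext fun e => e.2.elim) (funext fun _ => h)
  exact congrFun (congrArg Hom.onNode hab) PUnit.unit

/-- Monomorphisms are taken here among all directed graphs, where injectivity on nodes suffices
because the domain is simple. Simplicity of the codomain identifies the image of a lifted edge with
the given edge. -/
theorem dclosedDAG_eq : dclosedDAG.{u} = lowerEmbedding acyclic := by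
  ext X Y f
  constructor
  · rintro ⟨hm, hf⟩
    have hf' : Function.Injective (node f) := injective_onNode (acyclic.ι.map f)
    refine ⟨hf', fun v w hvw => ?_⟩
    obtain ⟨e, rfl, he⟩ := hvw
    obtain ⟨e', rfl⟩ := hf e ⟨w, he.symm⟩
    exact ⟨X.obj.source e', (Hom.source_onEdge f.hom e').symm, e', rfl,
      hf' ((Hom.target_onEdge f.hom e').symm.trans he)⟩
  · rintro ⟨hf, he⟩
    refine ⟨mono_of_injective_onNode X.property.1 _ hf, fun e ⟨w, hw⟩ => ?_⟩
    obtain ⟨u, hu, e', rfl, rfl⟩ := he (Y.obj.source e) w ⟨e, rfl, hw.symm⟩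
    exact ⟨e', Y.property.1 _ _ ((Hom.source_onEdge f.hom e').trans hu)
      ((Hom.target_onEdge f.hom e').trans hw)⟩

/-! ### Existence of limits and colimits; isomorphisms, composition and decomposition -/

theorem IsSimpleSieve.fullEmbedding_le_monomorphisms (hP : IsSimpleSieve P) :
    fullEmbedding P ≤ MorphismProperty.monomorphisms P.FullSubcategory :=
  fun _ _ _ hf => hP.mono_of_injective hf.1

theorem IsSimpleSieve.hasPullback (hP : IsSimpleSieve P) {X Y Z : P.FullSubcategory} (f : X ⟶ Z)
    (g : Y ⟶ Z) : HasPullback f g :=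
  let ⟨_, _, _, sq, _⟩ := hP.exists_isPullback f g
  sq.hasPullback

theorem IsSimpleSieve.hasPushout (hP : IsSimpleSieve P) {X Y Z : P.FullSubcategory} {f : X ⟶ Y}
    {g : X ⟶ Z} (h : P (ofRel (pushoutRel f g))) : HasPushout f g :=
  let ⟨_, _, _, sq, _⟩ := hP.exists_isPushout f g h
  sq.hasPushout

theorem isomorphisms_le_lowerEmbedding :
    MorphismProperty.isomorphisms P.FullSubcategory ≤ lowerEmbedding P := by
  intro X Y f hf
  obtain ⟨e, rfl⟩ : ∃ e : X ≅ Y, e.hom = f := ⟨@asIso _ _ _ _ f hf, rfl⟩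
  refine ⟨Function.LeftInverse.injective (node_hom_inv e), fun v w h => ?_⟩
  refine ⟨node e.inv v, node_inv_hom e v, ?_⟩
  simpa only [node_hom_inv] using adj_node e.inv h

theorem isomorphisms_le_fullEmbedding :
    MorphismProperty.isomorphisms P.FullSubcategory ≤ fullEmbedding P :=
  isomorphisms_le_lowerEmbedding.trans lowerEmbedding_le_fullEmbedding

theorem fullEmbedding_comp ⦃X Y Z : P.FullSubcategory⦄ (f : X ⟶ Y) (g : Y ⟶ Z)
    (hf : fullEmbedding P f) (hg : fullEmbedding P g) : fullEmbedding P (f ≫ g) :=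
  ⟨hg.1.comp hf.1, fun v w h => hf.2 v w (hg.2 _ _ h)⟩

theorem lowerEmbedding_comp ⦃X Y Z : P.FullSubcategory⦄ (f : X ⟶ Y) (g : Y ⟶ Z)
    (hf : lowerEmbedding P f) (hg : lowerEmbedding P g) : lowerEmbedding P (f ≫ g) := by
  refine ⟨hg.1.comp hf.1, fun v w h => ?_⟩
  obtain ⟨u, rfl, hu⟩ := hg.2 _ _ h
  obtain ⟨t, rfl, ht⟩ := hf.2 _ _ hu
  exact ⟨t, rfl, ht⟩

theorem fullEmbedding_of_comp {X Y Z : P.FullSubcategory} (f : X ⟶ Y) (g : Y ⟶ Z)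
    (h : fullEmbedding P (f ≫ g)) : fullEmbedding P f :=
  ⟨Function.Injective.of_comp h.1, fun v w hvw => h.2 v w (adj_node g hvw)⟩

theorem lowerEmbedding_of_comp {X Y Z : P.FullSubcategory} (f : X ⟶ Y) (g : Y ⟶ Z)
    (h : lowerEmbedding P (f ≫ g)) (hg : Function.Injective (node g)) : lowerEmbedding P f := by
  refine ⟨Function.Injective.of_comp h.1, fun v w hvw => ?_⟩
  obtain ⟨u, hu, huw⟩ := h.2 _ _ (adj_node g hvw)
  exact ⟨u, hg hu, huw⟩

theorem monomorphisms_of_comp {C : Type*} [Category* C] {X Y Z : C} (f : X ⟶ Y) (g : Y ⟶ Z)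
    (h : MorphismProperty.monomorphisms C (f ≫ g)) : MorphismProperty.monomorphisms C f :=
  have : Mono (f ≫ g) := h
  mono_of_mono f g

theorem isomorphisms_le_monomorphisms (C : Type*) [Category* C] :
    MorphismProperty.isomorphisms C ≤ MorphismProperty.monomorphisms C := fun _ _ f hf =>
  have : IsIso f := hf
  inferInstanceAs (Mono f)

end DirectedGraph

/-! ### The three adhesivity statements -/

open DirectedGraph in
theorem mainTheorem3 :
    IsAdhesiveWrt (MorphismProperty.regularMono SGraph.{u})
      (MorphismProperty.monomorphisms SGraph.{u}) ∧
    IsAdhesiveWrt (MorphismProperty.monomorphisms SGraph.{u})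
      (MorphismProperty.regularMono SGraph.{u}) ∧
    IsAdhesiveWrt dclosedDAG.{u} (MorphismProperty.monomorphisms DAG.{u}) := by
  have hS := isSimpleSieve_simple.{u}
  have hA := isSimpleSieve_acyclic.{u}
  rw [regularMono_simple, dclosedDAG_eq]
  refine ⟨?_, ?_, ?_⟩
  · exact
    { le_mono := hS.fullEmbedding_le_monomorphisms
      iso_left := isomorphisms_le_fullEmbedding
      iso_right := isomorphisms_le_monomorphisms _
      comp_left := fullEmbedding_comp
      comp_right := fun _ _ _ _ _ hf hg => MorphismProperty.comp_mem _ _ _ hf hg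
      decomp_left := fun _ _ _ f g h _ => fullEmbedding_of_comp f g h
      decomp_right := fun _ _ _ f g h _ => monomorphisms_of_comp f g h
      decomp_mixed := fun _ _ _ f g h _ => monomorphisms_of_comp f g h
      pullback_left := hS.isStableUnderBaseChange_fullEmbedding
      pullback_right := inferInstance
      pushout_left := hS.isStableUnderCobaseChange_fullEmbedding
      pushout_right := hS.isStableUnderCobaseChange_monomorphisms
      hasPullback := fun _ _ _ g m _ => hS.hasPullback g m
      hasPushout := fun _ _ _ m n _ _ => hS.hasPushout (isSimple_ofRel (pushoutRel m n))
      vanKampen := fun _ _ _ _ _ _ _ _ sq hm hn => hS.isVanKampen sq hm hn }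
  · exact
    { le_mono := le_rfl
      iso_left := isomorphisms_le_monomorphisms _
      iso_right := isomorphisms_le_fullEmbedding
      comp_left := fun _ _ _ _ _ hf hg => MorphismProperty.comp_mem _ _ _ hf hg
      comp_right := fullEmbedding_comp
      decomp_left := fun _ _ _ f g h _ => monomorphisms_of_comp f g h
      decomp_right := fun _ _ _ f g h _ => fullEmbedding_of_comp f g h
      decomp_mixed := fun _ _ _ f g h _ => fullEmbedding_of_comp f g h
      pullback_left := inferInstance
      pullback_right := hS.isStableUnderBaseChange_fullEmbedding
      pushout_left := hS.isStableUnderCobaseChange_monomorphisms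
      pushout_right := hS.isStableUnderCobaseChange_fullEmbedding
      hasPullback := fun _ _ _ g m _ => hS.hasPullback g m
      hasPushout := fun _ _ _ m n _ _ => hS.hasPushout (isSimple_ofRel (pushoutRel m n))
      -- The Van Kampen condition is symmetric in the two legs of the span, so the flipped square
      -- reduces to the previous case.
      vanKampen := fun _ _ _ _ _ _ _ _ sq hm hn => (hS.isVanKampen sq.flip hn hm).flip }
  · exact
    { le_mono := lowerEmbedding_le_fullEmbedding.trans hA.fullEmbedding_le_monomorphisms
      iso_left := isomorphisms_le_lowerEmbedding
      iso_right := isomorphisms_le_monomorphisms _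
      comp_left := lowerEmbedding_comp
      comp_right := fun _ _ _ _ _ hf hg => MorphismProperty.comp_mem _ _ _ hf hg
      decomp_left := fun _ _ _ f g h hg => lowerEmbedding_of_comp f g h hg.1
      decomp_right := fun _ _ _ f g h _ => monomorphisms_of_comp f g h
      decomp_mixed := fun _ _ _ f g h _ => monomorphisms_of_comp f g h
      pullback_left := hA.isStableUnderBaseChange_lowerEmbedding
      pullback_right := inferInstance
      pushout_left := hA.isStableUnderCobaseChange_lowerEmbedding
      pushout_right := hA.isStableUnderCobaseChange_monomorphisms
      hasPullback := fun _ _ _ g m _ => hA.hasPullback g m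
      hasPushout := fun _ _ _ _ _ hm hn => hA.hasPushout (acyclic_pushoutRel hm hn)
      vanKampen := fun _ _ _ _ _ _ _ _ sq hm hn =>
        hA.isVanKampen sq (lowerEmbedding_le_fullEmbedding _ hm) hn }
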